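/- \textbf{Setting.} Let $\Gamma$ be a finite extensive-form game with players $1,\dots,n$ and chance: a finite tree of nodes whose edges are labelled by actions, a set $\mathcal Z$ of terminal nodes, a partition of the decision nodes of each player $i$ into information sets (the same action set $A_I$ at all nodes of an information set $I$), probability distributions $p(\cdot\mid h)$ at chance nodes, and utilities $u_i:\mathcal Z\to[0,1]$. Let $T$ be the depth of the tree. The sequence $\sigma_i(h)$ is the list of the information sets of player $i$ passed, and of the actions taken there, on the path from the root to $h$, not including the information set of $h$. Assume perfect recall (for the player $i$ acting at $I$, $\sigma_i(h)$ is the same for all $h\in I$; it is denoted $\sigma(I)$), timeability (no information set spans several levels of the tree) and a fixed turn order (all non-terminal nodes of a level belong to the same player, or all to chance). Let $S$ be a finite set of messages containing, as pairwise distinct elements, the empty message $\bot$, all information sets and all actions. For each information set $I$ let $S_I\subseteq S$ be a set of legal messages with $\bot\in S_I$ and $I\in S_I$; write $\mathcal S=(S_I)_I$. A pure mediator strategy is a map $d:S^{\le T}\to S$; a mediator strategy is a probability distribution over pure mediator strategies. In the augmented game, a pure mediator strategy $d$ is drawn at the start and is not observed by the players. Whenever a player reaches a decision node, she observes her information set $I$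 and sends a message $s_t\in S_I$; she receives the reply $d(s_1,\dots,s_t)$, where $s_1,\dots,s_{t}$ are all messages sent so far by all players; then she chooses an action in $A_I$. The transcript with player $i$ is the list of the messages of $i$ and the replies to them. Pure strategies of player $i$ prescribe her message as a function of her information set and transcript, and her action as a function of her information set and the transcript including the current message and reply; mixed strategies are distributions over pure strategies, and the mediator's and all the players' draws are independent. An \emph{$\mathcal S$-certification equilibrium} is a mediator strategy together with mixed strategies of the players such that no player can raise her expected utility by changing only her own mixed strategy. Two such profiles are \emph{realization-equivalent} if for every $z\in\mathcal Z$ the probability that the mediator strategy and the pure strategies drawn play to $z$ (that is, the players choose every action of theirs on the path from the root to $z$) is the same under both; in particular they induce the same distribution over $\mathcal Z$. An $\mathcal S$-certification equilibrium is \emph{direct} if (1) every pure mediator strategy in the support of the mediator strategy has the following property: whenever player $i$ sends a message, if the message is an information set $I$ of player $i$ and the transcript with $i$ so far is exactly the sequence $\sigma(I)$, then the reply is an action in $A_I$, and otherwise the reply is $\bot$; and (2) every pure strategy in the support of each player's mixed strategy always reports the player's true information set $I$, and plays every action $a\in A_I$ that it receives as reply at $I$. \textbf{Proposition (revelation principle).}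 Assume that $\mathcal S$ satisfies the nested range condition: for all information sets $I,I'$, if $I\in S_{I'}$ then $S_I\subseteq S_{I'}$. Then for every $\mathcal S$-certification equilibrium there is a realization-equivalent direct $\mathcal S$-certification equilibrium. -/

import Mathlib

noncomputable section

namespace MediatedGame

/-- A finite extensive-form game with players `Fin n`, action labels in `A` and information sets
labelled by `Info`.  A node (history) is the list of the actions leading to it from the root `[]`,
the *latest action first*; so the child of `h` under the action `a` is `a :: h`. -/
structure ExtensiveGame (n : ℕ) (A Info : Type*) [Fintype A] where
  /-- the nodes of the tree -/
  hist : Finset (List A)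
  nil_mem : [] ∈ hist
  tail_mem : ∀ a h, a :: h ∈ hist → h ∈ hist
  /-- the information set of a non-terminal node; `none` at chance nodes -/
  infoset : List A → Option Info
  /-- the player to whom an information set belongs -/
  owner : Info → Fin n
  /-- information sets are the cells of a partition, so they are not empty -/
  infoset_nonempty : ∀ I, ∃ h ∈ hist, (∃ a, a :: h ∈ hist) ∧ infoset h = some I
  /-- the same actions are available at all nodes of an information set -/
  same_actions : ∀ I, ∀ h ∈ hist, ∀ h' ∈ hist, (∃ a, a :: h ∈ hist) → (∃ a, a :: h' ∈ hist) →
    infoset h = some I → infoset h' = some I → ∀ a, a :: h ∈ hist ↔ a :: h' ∈ hist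
  /-- the distribution over actions at chance nodes -/
  chance : List A → A → ℝ
  chance_nonneg : ∀ h ∈ hist, (∃ a, a :: h ∈ hist) → infoset h = none → ∀ a, 0 ≤ chance h a
  chance_support : ∀ h ∈ hist, (∃ a, a :: h ∈ hist) → infoset h = none →
    ∀ a, chance h a ≠ 0 → a :: h ∈ hist
  chance_sum : ∀ h ∈ hist, (∃ a, a :: h ∈ hist) → infoset h = none → ∑ a, chance h a = 1
  /-- the utility of each player at each terminal node -/
  utility : Fin n → List A → ℝ
  utility_mem : ∀ i, ∀ z ∈ hist, (∀ a, a :: z ∉ hist) → utility i z ∈ Set.Icc (0 : ℝ) 1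

namespace ExtensiveGame

variable {n : ℕ} {A Info : Type*} [Fintype A] (Γ : ExtensiveGame n A Info)

/-- `h` is a non-terminal node of the tree. -/
def Nonterminal (h : List A) : Prop := h ∈ Γ.hist ∧ ∃ a, a :: h ∈ Γ.hist

/-- The set of terminal nodes. -/
def terminals : Finset (List A) :=
  letI : DecidablePred fun z : List A => ∀ a, a :: z ∉ Γ.hist := Classical.decPred _
  Γ.hist.filter fun z => ∀ a, a :: z ∉ Γ.hist

/-- `h` is a (decision) node of the information set `I`. -/
def InInfoset (I : Info) (h : List A) : Prop := Γ.Nonterminal h ∧ Γ.infoset h = some I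

/-- The set `A_I` of actions available at the information set `I`. -/
def actionsAt (I : Info) : Set A := {a | ∃ h, Γ.InInfoset I h ∧ a :: h ∈ Γ.hist}

/-- The sequence `σ_i(h)`: the information sets of player `i` passed, and the actions taken there,
on the way to `h`, not including the information set of `h` itself (latest first). -/
def seq (i : Fin n) : List A → List (Info × A)
  | [] => []
  | a :: h =>
    match Γ.infoset h with
    | none => seq i h
    | some I => if Γ.owner I = i then (I, a) :: seq i h else seq i h

/-- `σ(I) = σ`: the player who acts at `I` has the sequence `σ` at every node of `I`. -/
def HasSeq (I : Info) (σ : List (Info × A)) : Prop :=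
  ∀ h, Γ.InInfoset I h → Γ.seq (Γ.owner I) h = σ

/-- Perfect recall: at all nodes of an information set the acting player has the same sequence. -/
def PerfectRecall : Prop := ∀ I, ∃ σ, Γ.HasSeq I σ

/-- Timeability: no information set spans several levels of the tree. -/
def Timeable : Prop := ∀ I h h', Γ.InInfoset I h → Γ.InInfoset I h' → h.length = h'.length

/-- The depth `T` of the tree. -/
def depth : ℕ := Γ.hist.sup List.length

/-- The product of the probabilities of all chance moves on the path to a node. -/
def chanceProb : List A → ℝ
  | [] => 1
  | a :: h =>
    match Γ.infoset h with
    | none => Γ.chance h a * chanceProb h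
    | some _ => chanceProb h

end ExtensiveGame

/-- An extensive-form game with perfect recall that is timeable and has a fixed turn order:
all non-terminal nodes of level `t` belong to the same player `turn t` (`none`: to chance). -/
structure TimedGame (n : ℕ) (A Info : Type*) [Fintype A] extends ExtensiveGame n A Info where
  turn : ℕ → Option (Fin n)
  turn_spec : ∀ h, toExtensiveGame.Nonterminal h →
    (toExtensiveGame.infoset h).map toExtensiveGame.owner = turn h.length
  perfectRecall : toExtensiveGame.PerfectRecall
  timeable : toExtensiveGame.Timeable

/-- The player who sends the message number `k` (counted from `0`) to the mediator; chance sends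
no messages. -/
def TimedGame.sender {n : ℕ} {A Info : Type*} [Fintype A] (Γ : TimedGame n A Info) (k : ℕ) :
    Option (Fin n) :=
  ((List.range Γ.depth).filterMap Γ.turn)[k]?

/-- A message space `S` together with the family of legal message sets.  The space contains,
through `code`, the empty message, all information sets and all actions; at each information set
the silent message and the honest message are legal. -/
structure MessageSystem (A Info S : Type*) where
  code : Option (Info ⊕ A) ↪ S
  /-- the messages that may be sent at an information set -/
  legal : Info → Set S
  bot_legal : ∀ I, code none ∈ legal I
  info_legal : ∀ I, code (some (Sum.inl I)) ∈ legal I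

namespace MessageSystem

variable {A Info S : Type*} (M : MessageSystem A Info S)

/-- the empty message `⊥` -/
def bot : S := M.code none

/-- the message that names an information set -/
def info (I : Info) : S := M.code (some (Sum.inl I))

/-- the message that names an action -/
def action (a : A) : S := M.code (some (Sum.inr a))

/-- The nested range condition: if `I` can be reported at `I'`, then all messages that are legal
at `I` are legal at `I'`. -/
def NestedRange : Prop := ∀ I I', M.info I ∈ M.legal I' → M.legal I ⊆ M.legal I'

end MessageSystem

/-- Lists of length at most `T`. -/
def ShortList (α : Type*) (T : ℕ) : Type _ := {l : List α // l.length ≤ T}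

instance {α : Type*} [Finite α] {T : ℕ} : Finite (ShortList α T) :=
  (List.finite_length_le α T).to_subtype

/-- A list as a `ShortList`; it is cut if it is too long, which does not happen in play. -/
def ShortList.ofList {α : Type*} {T : ℕ} (l : List α) : ShortList α T :=
  ⟨l.take T, List.length_take_le T l⟩

/-- A pure mediator strategy: the reply to each sequence of at most `T` messages (the messages of
all players, the latest first; the reply is sent to the sender of the latest message). -/
def PureMediator (S : Type*) (T : ℕ) : Type _ := ShortList S T → S

instance {S : Type*} [Finite S] {T : ℕ} : Finite (PureMediator S T) :=
  inferInstanceAs (Finite (ShortList S T → S))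

instance {S : Type*} [Finite S] {T : ℕ} : Fintype (PureMediator S T) := Fintype.ofFinite _

/-- The reply to the message sequence `l`. -/
def PureMediator.reply {S : Type*} {T : ℕ} (d : PureMediator S T) (l : List S) : S :=
  d (ShortList.ofList l)

section Play

variable {n : ℕ} {A Info S : Type*} [Fintype A] (Γ : TimedGame n A Info)
  (M : MessageSystem A Info S)

/-- The transcript with player `i` when all players together have sent the messages `l`: the list
of the pairs (message of `i`, reply of the mediator), the latest first. -/
def transcript (d : PureMediator S Γ.depth) (i : Fin n) : List S → List (S × S)
  | [] => []
  | s :: l =>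
    if Γ.sender l.length = some i then (s, d.reply (s :: l)) :: transcript d i l
    else transcript d i l

/-- A pure strategy of player `i` in the game augmented by a mediator.  By perfect recall, what
player `i` knows when she is to send a message is her information set and the transcript so far;
when she is to act, it is her information set and the transcript including the current message
and the reply to it. -/
@[ext]
structure PureStrategy (i : Fin n) where
  send : {I : Info // Γ.owner I = i} → ShortList (S × S) Γ.depth → S
  act : {I : Info // Γ.owner I = i} → ShortList (S × S) Γ.depth → A
  send_legal : ∀ I τ, send I τ ∈ M.legal I.1
  act_legal : ∀ I τ, act I τ ∈ Γ.actionsAt I.1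

instance [Finite Info] [Finite S] (i : Fin n) : Finite (PureStrategy Γ M i) :=
  Finite.of_injective
    (fun x : PureStrategy Γ M i => (x.send, x.act))
    (fun _ _ h => PureStrategy.ext (congrArg Prod.fst h) (congrArg Prod.snd h))

instance [Finite Info] [Finite S] (i : Fin n) : Fintype (PureStrategy Γ M i) := Fintype.ofFinite _

variable {Γ M}

/-- The messages sent on the path to a node, before that node is reached (the latest first), when
the players send messages according to `x` and the mediator replies according to `d`.  In
particular `messages d x (a :: h)` includes the message sent at `h`. -/
def messages (d : PureMediator S Γ.depth) (x : ∀ i, PureStrategy Γ M i) : List A → List S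
  | [] => []
  | _ :: h =>
    match Γ.infoset h with
    | none => messages d x h
    | some I =>
      (x (Γ.owner I)).send ⟨I, rfl⟩
        (ShortList.ofList (transcript Γ d (Γ.owner I) (messages d x h))) :: messages d x h

/-- The pure profile `x` plays to the node: with the mediator `d`, it plays every action of the
players on the path to that node. -/
def PlaysTo (d : PureMediator S Γ.depth) (x : ∀ i, PureStrategy Γ M i) : List A → Prop
  | [] => True
  | a :: h =>
    PlaysTo d x h ∧
      match Γ.infoset h with
      | none => True
      | some I =>
        (x (Γ.owner I)).act ⟨I, rfl⟩
          (ShortList.ofList (transcript Γ d (Γ.owner I) (messages d x (a :: h)))) = a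

variable [Fintype Info] [Fintype S]

variable (Γ M) in
/-- A randomized mediator strategy and a mixed strategy of each player, i.e. distributions over
the respective pure strategies. -/
structure Profile where
  mediator : stdSimplex ℝ (PureMediator S Γ.depth)
  player : ∀ i, stdSimplex ℝ (PureStrategy Γ M i)

namespace Profile

/-- The profile in which player `i` plays `y` instead, and all else is unchanged. -/
def deviate (e : Profile Γ M) (i : Fin n) (y : stdSimplex ℝ (PureStrategy Γ M i)) :
    Profile Γ M :=
  ⟨e.mediator, Function.update e.player i y⟩

open Classical in
/-- The realization form of a profile: the probability, when the mediator and the players draw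
their pure strategies independently, that the pure profile drawn plays to `z`. -/
def realization (e : Profile Γ M) (z : List A) : ℝ :=
  ∑ d : PureMediator S Γ.depth, ∑ x : ∀ i, PureStrategy Γ M i,
    e.mediator.1 d * (∏ i, (e.player i).1 (x i)) * (if PlaysTo d x z then 1 else 0)

/-- The expected utility of player `i`; the terminal node `z` is reached with probability
`chanceProb z * realization z`. -/
def expectedUtility (e : Profile Γ M) (i : Fin n) : ℝ :=
  ∑ z ∈ Γ.terminals, Γ.chanceProb z * e.realization z * Γ.utility i z

/-- Certification equilibrium: a Nash equilibrium of the game augmented by the mediator strategy,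
where the players are restricted to legal messages. -/
def IsCertificationEquilibrium (e : Profile Γ M) : Prop :=
  ∀ (i : Fin n) (y : stdSimplex ℝ (PureStrategy Γ M i)),
    (e.deviate i y).expectedUtility i ≤ e.expectedUtility i

/-- Two profiles are realization-equivalent if they have the same realization form on the
terminal nodes of the game. -/
def RealizationEquivalent (e e' : Profile Γ M) : Prop :=
  ∀ z ∈ Γ.terminals, e.realization z = e'.realization z

end Profile

variable (M) in
/-- After the messages `l`, player `i` makes a valid report of `I` by sending `s`: `I` is an
information set of player `i`, `s` names it, and the transcript with player `i` is exactly the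
sequence `σ(I)`. -/
def ValidReport (d : PureMediator S Γ.depth) (i : Fin n) (l : List S) (s : S) (I : Info) : Prop :=
  Γ.owner I = i ∧ s = M.info I ∧
    ∃ σ, Γ.HasSeq I σ ∧ transcript Γ d i l = σ.map fun p => (M.info p.1, M.action p.2)

variable (M) in
/-- Mediator directness: the reply to a valid report of `I` is an action of `A_I`, and the reply
to any other message is `⊥`. -/
def DirectMediator (d : PureMediator S Γ.depth) : Prop :=
  ∀ (l : List S) (s : S) (i : Fin n), (s :: l).length ≤ Γ.depth → Γ.sender l.length = some i →
    (∀ I, ValidReport M d i l s I → ∃ a ∈ Γ.actionsAt I, d.reply (s :: l) = M.action a) ∧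
    ((∀ I, ¬ ValidReport M d i l s I) → d.reply (s :: l) = M.bot)

/-- Player directness: always report the true information set, and play each action of `A_I`
that is received at `I`. -/
def DirectStrategy {i : Fin n} (x : PureStrategy Γ M i) : Prop :=
  (∀ I τ, x.send I τ = M.info I.1) ∧
    ∀ I (τ : ShortList (S × S) Γ.depth) (τ₀ : List (S × S)) (s : S), ∀ a ∈ Γ.actionsAt I.1,
      τ.1 = (s, M.action a) :: τ₀ → x.act I τ = a

/-- A direct equilibrium: a certification equilibrium in which the mediator and all players use
direct strategies only. -/
def Profile.IsDirectEquilibrium (e : Profile Γ M) : Prop :=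
  e.IsCertificationEquilibrium ∧
    (∀ d, e.mediator.1 d ≠ 0 → DirectMediator M d) ∧
    ∀ i x, (e.player i).1 x ≠ 0 → DirectStrategy x

end Play

end MediatedGame

end

/-! A mediator can take over the communication of a player: between player `i` and the original
mediator `d` put a *relay* that knows a pure strategy `x i` of hers. When she makes a valid report
of an information set, the relay sends to `d` what `x i` prescribes there, and passes on to her
the action that `x i` prescribes after the reply of `d`. A mediator that draws `d` and `x` and
runs all relays is direct.

Playing against the relays with strategies `w` is the same as playing against `d` with the
strategies in which every player runs her relay herself and uses `w i` towards it: by perfect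
recall her information set tells her the ones she has passed, so she can recompute her transcript
with the relay, and by the nested range condition every message of the relay is legal for her. If
`w i` is direct, then the strategy obtained in this way agrees with `x i` at every information set
and transcript that a player who takes the actions of `x i` can encounter, so it may be replaced
by `x i`. Hence direct play reproduces the original equilibrium, and a deviation of player `i` has
the effect of a deviation of player `i` alone from the original equilibrium, so it is not
profitable. -/

noncomputable section

namespace MediatedGame

section Expectation

variable {R α β : Type*} [CommSemiring R] [PartialOrder R] [Fintype α] [Fintype β]

/-- The expected value of `f` under the finite distribution `p`. -/
def expect (p : stdSimplex R α) (f : α → R) : R := ∑ a, p a * f a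

lemma expect_vertex [DecidableEq α] [IsOrderedRing R] (a : α) (f : α → R) :
    expect (stdSimplex.vertex a) f = f a := by
  simp [expect, Pi.single_apply]

variable [IsOrderedRing R]

lemma expect_map (f : α → β) (p : stdSimplex R α) (g : β → R) :
    expect (stdSimplex.map f p) g = expect p (g ∘ f) := by
  classical
  simp only [expect, stdSimplex.map_coe, FunOnFinite.linearMap_apply_apply, Finset.sum_mul,
    Function.comp_apply]
  rw [← Finset.sum_fiberwise Finset.univ f]
  refine Finset.sum_congr rfl fun b _ => Finset.sum_congr rfl fun a ha => ?_
  rw [(Finset.mem_filter.1 ha).2]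

lemma mem_range_of_map_ne_zero {f : α → β} {p : stdSimplex R α} {b : β}
    (hb : stdSimplex.map f p b ≠ 0) : b ∈ Set.range f := by
  classical
  rw [stdSimplex.map_coe, FunOnFinite.linearMap_apply_apply] at hb
  obtain ⟨a, ha, -⟩ := Finset.exists_ne_zero_of_sum_ne_zero hb
  exact ⟨a, (Finset.mem_filter.1 ha).2⟩

/-- The joint distribution of two independent draws. -/
def prodDist (p : stdSimplex R α) (q : stdSimplex R β) : stdSimplex R (α × β) :=
  ⟨fun c => p c.1 * q c.2, fun c => mul_nonneg (p.2.1 _) (q.2.1 _), by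
    simp [Fintype.sum_prod_type, ← Finset.mul_sum]⟩

lemma expect_prodDist (p : stdSimplex R α) (q : stdSimplex R β) (f : α × β → R) :
    expect (prodDist p q) f = expect p fun a => expect q fun b => f (a, b) := by
  simp only [expect, Fintype.sum_prod_type, Finset.mul_sum, ← mul_assoc]
  rfl

variable {ι : Type*} [Fintype ι] [DecidableEq ι] {κ : ι → Type*} [∀ i, Fintype (κ i)]

/-- The joint distribution of a family of independent draws. -/
def piDist (p : ∀ i, stdSimplex R (κ i)) : stdSimplex R (∀ i, κ i) :=
  ⟨fun x => ∏ i, p i (x i), fun _ => Finset.prod_nonneg fun i _ => (p i).2.1 _, by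
    rw [← Fintype.prod_sum]
    simp⟩

lemma piDist_vertex [∀ i, DecidableEq (κ i)] (a : ∀ i, κ i) :
    piDist (fun i => stdSimplex.vertex (S := R) (a i)) = stdSimplex.vertex a := by
  ext x
  change ∏ i, (Pi.single (a i) 1 : κ i → R) (x i) = (Pi.single a 1 : (∀ i, κ i) → R) x
  simp [Pi.single_apply, Finset.prod_ite_zero, funext_iff]

lemma piDist_update_apply (p : ∀ i, stdSimplex R (κ i)) (i : ι) (q : stdSimplex R (κ i))
    (x : ∀ i, κ i) :
    piDist (Function.update p i q) x = q (x i) * ∏ j ∈ Finset.univ.erase i, p j (x j) := by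
  change ∏ j, Function.update p i q j (x j) = _
  rw [← Finset.mul_prod_erase _ _ (Finset.mem_univ i), Function.update_self]
  congr 1
  refine Finset.prod_congr rfl fun j hj => ?_
  rw [Function.update_of_ne (Finset.ne_of_mem_erase hj)]

lemma expect_piDist_update (p : ∀ i, stdSimplex R (κ i)) (i : ι) (q : stdSimplex R (κ i))
    (f : (∀ i, κ i) → R) :
    expect (piDist (Function.update p i q)) f =
      expect (piDist p) fun x => expect q fun b => f (Function.update x i b) := by
  -- On the left `f` sees a draw from `q`, and on the right it sees `b` in the place of a discarded
  -- draw `x i`; exchanging `x i` with `b` matches the two sums.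
  have hswap : Function.Involutive fun c : (∀ i, κ i) × κ i => (Function.update c.1 i c.2, c.1 i) :=
    fun c => by simp
  have hp (x : ∀ i, κ i) : piDist p x = p i (x i) * ∏ j ∈ Finset.univ.erase i, p j (x j) := by
    simpa using piDist_update_apply p i (p i) x
  have herase (x : ∀ i, κ i) (b : κ i) : ∏ j ∈ Finset.univ.erase i, p j (Function.update x i b j) =
      ∏ j ∈ Finset.univ.erase i, p j (x j) :=
    Finset.prod_congr rfl fun j hj => by rw [Function.update_of_ne (Finset.ne_of_mem_erase hj)]
  calc
    expect (piDist (Function.update p i q)) f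
      = ∑ c : (∀ i, κ i) × κ i,
          p i c.2 * (q (c.1 i) * (∏ j ∈ Finset.univ.erase i, p j (c.1 j)) * f c.1) := by
        simp [expect, piDist_update_apply, Fintype.sum_prod_type, ← Finset.sum_mul]
    _ = ∑ c : (∀ i, κ i) × κ i, piDist p c.1 * (q c.2 * f (Function.update c.1 i c.2)) := by
        refine Fintype.sum_equiv hswap.toPerm _ _ fun c => ?_
        simp only [Function.Involutive.coe_toPerm, hp, herase, Function.update_self,
          Function.update_idem, Function.update_eq_self]
        ring
    _ = _ := by simp only [expect, Fintype.sum_prod_type, Finset.mul_sum]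

end Expectation

lemma ShortList.val_ofList {α : Type*} {T : ℕ} {l : List α} (h : l.length ≤ T) :
    (ShortList.ofList l : ShortList α T).1 = l :=
  List.take_of_length_le h

lemma ShortList.ofList_val {α : Type*} {T : ℕ} (l : ShortList α T) : ShortList.ofList l.1 = l :=
  Subtype.ext (ShortList.val_ofList l.2)

lemma ShortList.head?_val_ofList_cons {α : Type*} {T : ℕ} (hT : T ≠ 0) (a : α) (l : List α) :
    (ShortList.ofList (a :: l) : ShortList α T).1.head? = some a := by
  simp [ShortList.ofList, List.head?_take, hT]

namespace MessageSystem

variable {A Info S : Type*} (M : MessageSystem A Info S)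

lemma info_injective : Function.Injective M.info := fun I J h => by
  simpa using M.code.injective h

lemma action_injective : Function.Injective M.action := fun a b h => by
  simpa using M.code.injective h

/-- The transcript of a player who has reported the information sets of `σ` and has been told to
play the actions of `σ`. -/
def encode (σ : List (Info × A)) : List (S × S) := σ.map fun p => (M.info p.1, M.action p.2)

lemma encode_cons (p : Info × A) (σ : List (Info × A)) :
    M.encode (p :: σ) = (M.info p.1, M.action p.2) :: M.encode σ :=
  rfl

end MessageSystem

variable {n : ℕ} {A Info S : Type*} [Fintype A]

namespace ExtensiveGame

variable (Γ : ExtensiveGame n A Info)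

lemma exists_inInfoset (I : Info) : ∃ h, Γ.InInfoset I h := by
  obtain ⟨h, hh, ha, hI⟩ := Γ.infoset_nonempty I
  exact ⟨h, ⟨hh, ha⟩, hI⟩

lemma actionsAt_nonempty (I : Info) : (Γ.actionsAt I).Nonempty := by
  obtain ⟨h, hI⟩ := Γ.exists_inInfoset I
  obtain ⟨a, ha⟩ := hI.1.2
  exact ⟨a, h, hI, ha⟩

variable {Γ}

lemma mem_hist_of_mem_terminals {z : List A} (hz : z ∈ Γ.terminals) : z ∈ Γ.hist := by
  simp only [terminals, Finset.mem_filter] at hz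
  exact hz.1

lemma length_le_depth {h : List A} (hh : h ∈ Γ.hist) : h.length ≤ Γ.depth :=
  Finset.le_sup (f := List.length) hh

lemma seq_cons_of_infoset_eq_none {h : List A} (hI : Γ.infoset h = none) (a : A) (i : Fin n) :
    Γ.seq i (a :: h) = Γ.seq i h := by
  simp only [seq, hI]

lemma seq_cons_of_inInfoset {I : Info} {h : List A} (hI : Γ.InInfoset I h) (a : A) (i : Fin n) :
    Γ.seq i (a :: h) = if Γ.owner I = i then (I, a) :: Γ.seq i h else Γ.seq i h := by
  simp only [seq, hI.2]

@[elab_as_elim]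
lemma hist_induction {motive : ∀ h, h ∈ Γ.hist → Prop} (nil : motive [] Γ.nil_mem)
    (chance : ∀ a h (hah : a :: h ∈ Γ.hist), Γ.infoset h = none →
      motive h (Γ.tail_mem a h hah) → motive (a :: h) hah)
    (decision : ∀ a h (hah : a :: h ∈ Γ.hist) I, Γ.InInfoset I h →
      motive h (Γ.tail_mem a h hah) → motive (a :: h) hah)
    (h : List A) (hh : h ∈ Γ.hist) : motive h hh := by
  induction h with
  | nil => exact nil
  | cons a h ih =>
    rcases hI : Γ.infoset h with _ | I
    · exact chance a h hh hI (ih _)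
    · exact decision a h hh I ⟨⟨Γ.tail_mem a h hh, a, hh⟩, hI⟩ (ih _)

end ExtensiveGame

open ExtensiveGame

variable {Γ : TimedGame n A Info} {M : MessageSystem A Info S}

namespace TimedGame

/-- The sequence `σ(I)` of the player who acts at `I`. -/
def infoSeq (Γ : TimedGame n A Info) (I : Info) : List (Info × A) := (Γ.perfectRecall I).choose

lemma seq_eq_infoSeq {I : Info} {h : List A} (hI : Γ.InInfoset I h) :
    Γ.seq (Γ.owner I) h = Γ.infoSeq I :=
  (Γ.perfectRecall I).choose_spec h hI

lemma hasSeq_iff {I : Info} {σ : List (Info × A)} : Γ.HasSeq I σ ↔ σ = Γ.infoSeq I := by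
  refine ⟨fun hσ => ?_, fun hσ h hI => hσ ▸ seq_eq_infoSeq hI⟩
  obtain ⟨h, hI⟩ := Γ.exists_inInfoset I
  exact (hσ h hI).symm.trans (seq_eq_infoSeq hI)

end TimedGame

open TimedGame

section Play

variable (d : PureMediator S Γ.depth) (x : ∀ i, PureStrategy Γ M i)

lemma length_transcript_le (i : Fin n) (l : List S) : (transcript Γ d i l).length ≤ l.length := by
  induction l with
  | nil => simp [transcript]
  | cons s l ih =>
    rw [transcript]
    split_ifs <;> simp only [List.length_cons] <;> omega

lemma messages_cons_of_infoset_eq_none {h : List A} (hI : Γ.infoset h = none) (a : A) :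
    messages d x (a :: h) = messages d x h := by
  rw [messages]
  split <;> simp_all

lemma messages_cons_of_inInfoset {I : Info} {h : List A} (hI : Γ.InInfoset I h) (a : A) :
    messages d x (a :: h) = (x (Γ.owner I)).send ⟨I, rfl⟩
      (.ofList (transcript Γ d (Γ.owner I) (messages d x h))) :: messages d x h := by
  rw [messages]
  split
  · simp_all [InInfoset]
  · rename_i J hJ
    obtain rfl : J = I := by simpa [hJ] using hI.2
    rfl

lemma playsTo_cons_of_infoset_eq_none {h : List A} (hI : Γ.infoset h = none) (a : A) :
    PlaysTo d x (a :: h) ↔ PlaysTo d x h := by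
  rw [PlaysTo]
  split <;> simp_all

lemma playsTo_cons_of_inInfoset {I : Info} {h : List A} (hI : Γ.InInfoset I h) (a : A) :
    PlaysTo d x (a :: h) ↔ PlaysTo d x h ∧ (x (Γ.owner I)).act ⟨I, rfl⟩
      (.ofList (transcript Γ d (Γ.owner I) (messages d x (a :: h)))) = a := by
  rw [PlaysTo]
  split
  · simp_all [InInfoset]
  · rename_i J hJ
    obtain rfl : J = I := by simpa [hJ] using hI.2
    rfl

lemma length_messages {h : List A} (hh : h ∈ Γ.hist) :
    (messages d x h).length = ((List.range h.length).filterMap Γ.turn).length := by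
  induction h, hh using hist_induction with
  | nil => simp [messages]
  | chance a h hah hI ih =>
    have hturn := Γ.turn_spec h ⟨Γ.tail_mem a h hah, a, hah⟩
    rw [hI] at hturn
    simp [messages_cons_of_infoset_eq_none d x hI, ih, List.range_succ, ← hturn]
  | decision a h _ I hI ih =>
    have hturn := Γ.turn_spec h hI.1
    rw [hI.2] at hturn
    simp [messages_cons_of_inInfoset d x hI, ih, List.range_succ, ← hturn]

lemma length_messages_le {h : List A} (hh : h ∈ Γ.hist) : (messages d x h).length ≤ Γ.depth := by
  rw [length_messages d x hh]
  refine (List.length_filterMap_le _ _).trans ?_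
  simpa using length_le_depth hh

lemma sender_length_messages {I : Info} {h : List A} (hI : Γ.InInfoset I h) :
    Γ.sender (messages d x h).length = some (Γ.owner I) := by
  have hturn := Γ.turn_spec h hI.1
  rw [hI.2, Option.map_some] at hturn
  obtain ⟨hh, a, ha⟩ := hI.1
  obtain ⟨k, hk⟩ := Nat.exists_eq_add_of_le (show h.length + 1 ≤ Γ.depth from length_le_depth ha)
  rw [length_messages d x hh, sender, hk, List.range_add, List.range_succ]
  simp [List.filterMap_append, ← hturn]

lemma transcript_cons_messages {I : Info} {h : List A} (hI : Γ.InInfoset I h) (i : Fin n) (s : S) :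
    transcript Γ d i (s :: messages d x h) =
      if Γ.owner I = i then (s, d.reply (s :: messages d x h)) :: transcript Γ d i (messages d x h)
      else transcript Γ d i (messages d x h) := by
  simp [transcript, sender_length_messages d x hI]

lemma val_ofList_transcript_messages (i : Fin n) {h : List A} (hh : h ∈ Γ.hist) :
    (ShortList.ofList (transcript Γ d i (messages d x h)) : ShortList _ Γ.depth).1 =
      transcript Γ d i (messages d x h) :=
  ShortList.val_ofList ((length_transcript_le d i _).trans (length_messages_le d x hh))

end Play

section OwnPlay

variable {i : Fin n}

/-- `Consistent x σ τ` says that a player who uses `x` can have the sequence `σ` and the transcript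
`τ` when she is next to move, whatever the other players and the mediator do.  Only the actions of
`x` are taken into account, and not its messages. -/
inductive Consistent (x : PureStrategy Γ M i) : List (Info × A) → List (S × S) → Prop
  | nil : Consistent x [] []
  | cons (I : {I : Info // Γ.owner I = i}) (p : S × S) {τ : List (S × S)} {a : A} :
    Consistent x (Γ.infoSeq I.1) τ → x.act I (.ofList (p :: τ)) = a →
      Consistent x ((I.1, a) :: Γ.infoSeq I.1) (p :: τ)

/-- The strategies `x'` and `x` prescribe the same at all information sets and transcripts that a
player who uses `x` can have. -/
structure AgreesOnOwnPlay (x' x : PureStrategy Γ M i) : Prop where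
  send : ∀ I τ, Consistent x (Γ.infoSeq I.1) τ.1 → x'.send I τ = x.send I τ
  act : ∀ I (τ : ShortList (S × S) Γ.depth) p τ₀, τ.1 = p :: τ₀ →
    Consistent x (Γ.infoSeq I.1) τ₀ → x'.act I τ = x.act I τ

lemma AgreesOnOwnPlay.refl (x : PureStrategy Γ M i) : AgreesOnOwnPlay x x :=
  ⟨fun _ _ _ => rfl, fun _ _ _ _ _ _ => rfl⟩

variable {d : PureMediator S Γ.depth} {x x' : ∀ i, PureStrategy Γ M i} {h : List A}

lemma PlaysTo.consistent (hh : h ∈ Γ.hist) (hx : PlaysTo d x h) (i : Fin n) :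
    Consistent (x i) (Γ.seq i h) (transcript Γ d i (messages d x h)) := by
  induction h, hh using hist_induction with
  | nil => exact .nil
  | chance a h _ hI ih =>
    rw [playsTo_cons_of_infoset_eq_none d x hI] at hx
    rw [seq_cons_of_infoset_eq_none hI, messages_cons_of_infoset_eq_none d x hI]
    exact ih hx
  | decision a h _ I hI ih =>
    rw [playsTo_cons_of_inInfoset d x hI] at hx
    obtain ⟨hx, ha⟩ := hx
    specialize ih hx
    rw [messages_cons_of_inInfoset d x hI, transcript_cons_messages d x hI] at ha ⊢
    rw [seq_cons_of_inInfoset hI]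
    rw [if_pos rfl] at ha
    split_ifs with hi
    · subst hi
      rw [seq_eq_infoSeq hI] at ih ⊢
      exact .cons ⟨I, rfl⟩ _ ih ha
    · exact ih

lemma PlaysTo.consistent_infoSeq {I : Info} (hI : Γ.InInfoset I h) (hx : PlaysTo d x h) :
    Consistent (x (Γ.owner I)) (Γ.infoSeq I) (transcript Γ d (Γ.owner I) (messages d x h)) :=
  seq_eq_infoSeq hI ▸ hx.consistent hI.1.1 _

lemma send_congr_of_agreesOnOwnPlay (hxx' : ∀ i, AgreesOnOwnPlay (x' i) (x i)) {I : Info}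
    (hI : Γ.InInfoset I h) (hx : PlaysTo d x h) :
    (x' (Γ.owner I)).send ⟨I, rfl⟩ (.ofList (transcript Γ d (Γ.owner I) (messages d x h))) =
      (x (Γ.owner I)).send ⟨I, rfl⟩ (.ofList (transcript Γ d (Γ.owner I) (messages d x h))) := by
  refine (hxx' _).send _ _ ?_
  rw [val_ofList_transcript_messages d x _ hI.1.1]
  exact hx.consistent_infoSeq hI

lemma act_congr_of_agreesOnOwnPlay (hxx' : ∀ i, AgreesOnOwnPlay (x' i) (x i)) {I : Info}
    (hI : Γ.InInfoset I h) {a : A} (hah : a :: h ∈ Γ.hist) (hx : PlaysTo d x h) :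
    (x' (Γ.owner I)).act ⟨I, rfl⟩ (.ofList (transcript Γ d (Γ.owner I) (messages d x (a :: h)))) =
      (x (Γ.owner I)).act ⟨I, rfl⟩
        (.ofList (transcript Γ d (Γ.owner I) (messages d x (a :: h)))) := by
  obtain ⟨p, hp⟩ : ∃ p, transcript Γ d (Γ.owner I) (messages d x (a :: h)) =
      p :: transcript Γ d (Γ.owner I) (messages d x h) :=
    ⟨_, by rw [messages_cons_of_inInfoset d x hI, transcript_cons_messages d x hI, if_pos rfl]⟩
  exact (hxx' _).act _ _ p _ (by rw [val_ofList_transcript_messages d x _ hah, hp])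
    (hx.consistent_infoSeq hI)

lemma messages_congr_of_agreesOnOwnPlay (hxx' : ∀ i, AgreesOnOwnPlay (x' i) (x i))
    (hh : h ∈ Γ.hist) (hx : PlaysTo d x h) : messages d x' h = messages d x h := by
  induction h, hh using hist_induction with
  | nil => rfl
  | chance a h _ hI ih =>
    rw [playsTo_cons_of_infoset_eq_none d x hI] at hx
    simp only [messages_cons_of_infoset_eq_none d _ hI, ih hx]
  | decision a h _ I hI ih =>
    have hx := ((playsTo_cons_of_inInfoset d x hI a).1 hx).1
    simp only [messages_cons_of_inInfoset d _ hI, ih hx, send_congr_of_agreesOnOwnPlay hxx' hI hx]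

lemma playsTo_congr_of_agreesOnOwnPlay (hxx' : ∀ i, AgreesOnOwnPlay (x' i) (x i))
    (hh : h ∈ Γ.hist) : PlaysTo d x' h ↔ PlaysTo d x h := by
  induction h, hh using hist_induction with
  | nil => rfl
  | chance a h _ hI ih => simpa only [playsTo_cons_of_infoset_eq_none d _ hI] using ih
  | decision a h hah I hI ih =>
    rw [playsTo_cons_of_inInfoset d x' hI, playsTo_cons_of_inInfoset d x hI, ih]
    refine and_congr_right fun hx => ?_
    have hmessages : messages d x' (a :: h) = messages d x (a :: h) := by
      simp only [messages_cons_of_inInfoset d _ hI,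
        messages_congr_of_agreesOnOwnPlay hxx' hI.1.1 hx, send_congr_of_agreesOnOwnPlay hxx' hI hx]
    rw [hmessages, act_congr_of_agreesOnOwnPlay hxx' hI hah hx]

end OwnPlay

section Relay

variable {i : Fin n}

variable (Γ M i) in
/-- The information set of which player `i` makes a valid report by sending `s` after the
transcript `δ`; `none` if the report is not valid. -/
def reportedInfoset (δ : List (S × S)) (s : S) : Option {I : Info // Γ.owner I = i} :=
  Function.partialInv (fun I => (M.info I.1, M.encode (Γ.infoSeq I.1))) (s, δ)

lemma reportedInfoset_eq_some_iff {δ : List (S × S)} {s : S} {I : {I : Info // Γ.owner I = i}} :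
    reportedInfoset Γ M i δ s = some I ↔ s = M.info I.1 ∧ δ = M.encode (Γ.infoSeq I.1) := by
  have hinj : Function.Injective fun I : {I : Info // Γ.owner I = i} =>
      (M.info I.1, M.encode (Γ.infoSeq I.1)) :=
    fun I J h => Subtype.ext (M.info_injective (congrArg Prod.fst h))
  rw [reportedInfoset, hinj.isPartialInv I, Prod.mk.injEq]
  exact and_congr eq_comm eq_comm

lemma reportedInfoset_encode (I : {I : Info // Γ.owner I = i}) :
    reportedInfoset Γ M i (M.encode (Γ.infoSeq I.1)) (M.info I.1) = some I :=
  reportedInfoset_eq_some_iff.2 ⟨rfl, rfl⟩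

variable (x : PureStrategy Γ M i) (δ : List (S × S)) (s : S) (τ : List (S × S))

/-- The message that a relay sends to the original mediator on behalf of a player who reports `s`:
`δ` is the transcript of the player with the relay, and `τ` that of the relay with the mediator. A
valid report of `I` makes the relay send what `x` sends at `I`. -/
def relayedMessage : S :=
  (reportedInfoset Γ M i δ s).elim M.bot fun I => x.send I (.ofList τ)

/-- The reply of the relay to the report `s`, where `τ` now includes the message sent on behalf of
the player and the reply to it. A valid report of `I` is answered by the action of `x` at `I`. -/
def relayedReply : S :=
  (reportedInfoset Γ M i δ s).elim M.bot fun I => M.action (x.act I (.ofList τ))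

lemma relayedMessage_encode (I : {I : Info // Γ.owner I = i}) :
    relayedMessage x (M.encode (Γ.infoSeq I.1)) (M.info I.1) τ = x.send I (.ofList τ) := by
  rw [relayedMessage, reportedInfoset_encode, Option.elim_some]

lemma relayedReply_encode (I : {I : Info // Γ.owner I = i}) :
    relayedReply x (M.encode (Γ.infoSeq I.1)) (M.info I.1) τ =
      M.action (x.act I (.ofList τ)) := by
  rw [relayedReply, reportedInfoset_encode, Option.elim_some]

variable {s} in
/-- This is where the nested range condition enters: whatever a player may report at `I`, the
message relayed on her behalf is one that she could have sent herself. -/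
lemma relayedMessage_mem_legal (hM : M.NestedRange) {I : Info} (hs : s ∈ M.legal I) :
    relayedMessage x δ s τ ∈ M.legal I := by
  rcases hJ : reportedInfoset Γ M i δ s with _ | J
  · rw [relayedMessage, hJ]
    exact M.bot_legal I
  · obtain ⟨rfl, -⟩ := reportedInfoset_eq_some_iff.1 hJ
    rw [relayedMessage, hJ]
    exact hM _ _ hs (x.send_legal _ _)

end Relay

section DirectMediator

variable (d : PureMediator S Γ.depth) (x : ∀ i, PureStrategy Γ M i)

mutual

/-- The messages that the relays with strategies `x` send to `d` when the players together report
the given list. -/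
def relayedMessages : List S → List S
  | [] => []
  | s :: l =>
    (Γ.sender l.length).elim M.bot (fun i =>
      relayedMessage (x i) (relayTranscript i l) s (transcript Γ d i (relayedMessages l))) ::
        relayedMessages l
termination_by l => (l.length, 0)

/-- The transcript of player `i` with her relay when the players together report the given list. -/
def relayTranscript (i : Fin n) : List S → List (S × S)
  | [] => []
  | s :: l =>
    if Γ.sender l.length = some i then
      (s, relayedReply (x i) (relayTranscript i l) s
        (transcript Γ d i (relayedMessages (s :: l)))) :: relayTranscript i l
    else relayTranscript i l
termination_by l => (l.length, 1)

end

/-- The mediator that runs all relays, together with the mediator `d` to which they talk. -/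
def directMediator : PureMediator S Γ.depth := fun l =>
  match l.1 with
  | [] => M.bot
  | s :: l =>
    (Γ.sender l.length).elim M.bot fun i =>
      relayedReply (x i) (relayTranscript d x i l) s
        (transcript Γ d i (relayedMessages d x (s :: l)))

variable {i : Fin n} {l : List S} {s : S}

lemma directMediator_reply (hi : Γ.sender l.length = some i) (hl : (s :: l).length ≤ Γ.depth) :
    (directMediator d x).reply (s :: l) = relayedReply (x i) (relayTranscript d x i l) s
      (transcript Γ d i (relayedMessages d x (s :: l))) := by
  simp only [PureMediator.reply, directMediator, ShortList.val_ofList hl, hi, Option.elim_some]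

lemma transcript_directMediator (i : Fin n) (hl : l.length ≤ Γ.depth) :
    transcript Γ (directMediator d x) i l = relayTranscript d x i l := by
  induction l with
  | nil => rw [transcript, relayTranscript]
  | cons s l ih =>
    rw [transcript, relayTranscript, ih ((Nat.le_succ _).trans hl)]
    split_ifs with hi
    · rw [directMediator_reply d x hi hl]
    · rfl

lemma validReport_directMediator_iff (hl : l.length ≤ Γ.depth) {I : Info} :
    ValidReport M (directMediator d x) i l s I ↔
      ∃ h : Γ.owner I = i, reportedInfoset Γ M i (relayTranscript d x i l) s = some ⟨I, h⟩ := by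
  simp only [ValidReport, reportedInfoset_eq_some_iff, hasSeq_iff,
    transcript_directMediator d x i hl, exists_eq_left, exists_prop, MessageSystem.encode]

lemma directMediator_directMediator : DirectMediator M (directMediator d x) := by
  intro l s i hl hi
  simp only [validReport_directMediator_iff d x ((Nat.le_succ _).trans hl),
    directMediator_reply d x hi hl, relayedReply]
  constructor
  · rintro I ⟨h, hI⟩
    exact ⟨_, (x i).act_legal ⟨I, h⟩ _, by rw [hI, Option.elim_some]⟩
  · intro hnone
    have hreport : reportedInfoset Γ M i (relayTranscript d x i l) s = none :=
      Option.eq_none_iff_forall_ne_some.2 fun I hI => hnone I.1 ⟨I.2, hI⟩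
    rw [hreport, Option.elim_none]

end DirectMediator

section RelayedStrategy

variable {i : Fin n}

/-- The transcript with the relay of a player who uses `y` towards it, recovered from the
information sets that she has passed and from the transcript of the relay with the original
mediator. -/
def recoveredTranscript (x y : PureStrategy Γ M i) : List Info → List (S × S) → List (S × S)
  | I :: σ, p :: τ =>
    if h : Γ.owner I = i then
      let δ := recoveredTranscript x y σ τ
      let s := y.send ⟨I, h⟩ (.ofList δ)
      (s, relayedReply x δ s (p :: τ)) :: δ
    else []
  | _, _ => []

/-- The strategy of a player who runs the relay herself and uses `y` towards it. -/
def relayedStrategy (hM : M.NestedRange) (x y : PureStrategy Γ M i) : PureStrategy Γ M i where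
  send I τ :=
    let δ := recoveredTranscript x y ((Γ.infoSeq I.1).map Prod.fst) τ.1
    relayedMessage x δ (y.send I (.ofList δ)) τ.1
  act I τ := y.act I
    (.ofList (recoveredTranscript x y (I.1 :: (Γ.infoSeq I.1).map Prod.fst) τ.1))
  send_legal I _ := relayedMessage_mem_legal x _ _ hM (y.send_legal I _)
  act_legal I _ := y.act_legal I _

variable (hM : M.NestedRange) (d : PureMediator S Γ.depth) (x w : ∀ i, PureStrategy Γ M i)
  {h : List A}

lemma relayedMessages_messages_and_relayTranscript_messages (hh : h ∈ Γ.hist) :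
    relayedMessages d x (messages (directMediator d x) w h) =
        messages d (fun i => relayedStrategy hM (x i) (w i)) h ∧
      ∀ i, relayTranscript d x i (messages (directMediator d x) w h) =
        recoveredTranscript (x i) (w i) ((Γ.seq i h).map Prod.fst)
          (transcript Γ d i (messages d (fun i => relayedStrategy hM (x i) (w i)) h)) := by
  induction h, hh using hist_induction with
  | nil => simp [messages, relayedMessages, relayTranscript, seq, recoveredTranscript]
  | chance a h _ hI ih =>
    simpa only [messages_cons_of_infoset_eq_none _ _ hI, seq_cons_of_infoset_eq_none hI] using ih
  | decision a h _ I hI ih =>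
    obtain ⟨hmessages, htranscript⟩ := ih
    have hsend : relayedMessages d x (messages (directMediator d x) w (a :: h)) =
        messages d (fun i => relayedStrategy hM (x i) (w i)) (a :: h) := by
      rw [messages_cons_of_inInfoset _ _ hI, messages_cons_of_inInfoset _ _ hI, relayedMessages,
        sender_length_messages _ _ hI, Option.elim_some, hmessages]
      simp only [relayedStrategy, val_ofList_transcript_messages _ _ _ hI.1.1, htranscript,
        seq_eq_infoSeq hI, transcript_directMediator d x _ (length_messages_le _ _ hI.1.1)]
    refine ⟨hsend, fun i => ?_⟩
    rw [messages_cons_of_inInfoset d _ hI, messages_cons_of_inInfoset _ w hI] at hsend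
    rw [messages_cons_of_inInfoset d _ hI, messages_cons_of_inInfoset _ w hI]
    rw [relayTranscript, sender_length_messages _ _ hI, hsend, transcript_cons_messages _ _ hI,
      seq_cons_of_inInfoset hI]
    by_cases hi : Γ.owner I = i
    · subst hi
      simp only [if_true, List.map_cons, recoveredTranscript, dif_pos, ← htranscript,
        transcript_directMediator d x _ (length_messages_le _ _ hI.1.1)]
    · simp only [hi, Option.some.injEq, if_false, htranscript]

lemma playsTo_directMediator_iff (hh : h ∈ Γ.hist) :
    PlaysTo (directMediator d x) w h ↔
      PlaysTo d (fun i => relayedStrategy hM (x i) (w i)) h := by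
  induction h, hh using hist_induction with
  | nil => rfl
  | chance a h _ hI ih => simpa only [playsTo_cons_of_infoset_eq_none _ _ hI] using ih
  | decision a h hah I hI ih =>
    have htranscript :=
      (relayedMessages_messages_and_relayTranscript_messages hM d x w hah).2 (Γ.owner I)
    rw [← transcript_directMediator d x _ (length_messages_le _ _ hah),
      seq_cons_of_inInfoset hI, if_pos rfl, seq_eq_infoSeq hI, List.map_cons] at htranscript
    rw [playsTo_cons_of_inInfoset _ _ hI, playsTo_cons_of_inInfoset _ _ hI, ih, htranscript]
    simp only [relayedStrategy, val_ofList_transcript_messages _ _ _ hah]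

end RelayedStrategy

section DirectStrategy

variable (Γ M) in
open Classical in
/-- A direct strategy of player `i`. If the reply names no available action, then it plays an
arbitrary one. -/
def directStrategy (i : Fin n) : PureStrategy Γ M i where
  send I _ := M.info I.1
  act I τ :=
    if h : ∃ a ∈ Γ.actionsAt I.1, τ.1.head?.map Prod.snd = some (M.action a) then h.choose
    else (Γ.actionsAt_nonempty I.1).some
  send_legal I _ := M.info_legal I.1
  act_legal I τ := by
    split_ifs with h
    · exact h.choose_spec.1
    · exact (Γ.actionsAt_nonempty I.1).some_mem

variable {i : Fin n}

lemma directStrategy_send (I : {I : Info // Γ.owner I = i}) (τ : ShortList (S × S) Γ.depth) :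
    (directStrategy Γ M i).send I τ = M.info I.1 :=
  rfl

lemma directStrategy_act {I : {I : Info // Γ.owner I = i}} {τ : ShortList (S × S) Γ.depth} {s : S}
    {a : A} (ha : a ∈ Γ.actionsAt I.1) (hτ : τ.1.head? = some (s, M.action a)) :
    (directStrategy Γ M i).act I τ = a := by
  have hex : ∃ b ∈ Γ.actionsAt I.1, τ.1.head?.map Prod.snd = some (M.action b) :=
    ⟨a, ha, by rw [hτ, Option.map_some]⟩
  have hchoose : some (M.action a) = some (M.action hex.choose) :=
    (congrArg (Option.map Prod.snd) hτ).symm.trans hex.choose_spec.2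
  simpa only [directStrategy, dif_pos hex] using
    (M.action_injective (Option.some_injective _ hchoose)).symm

lemma directStrategy_directStrategy (i : Fin n) : DirectStrategy (directStrategy Γ M i) :=
  ⟨fun _ _ => rfl, fun _ _ _ _ _ ha hτ => directStrategy_act ha (by rw [hτ, List.head?_cons])⟩

lemma Consistent.recoveredTranscript_directStrategy {x : PureStrategy Γ M i}
    {σ : List (Info × A)} {τ : List (S × S)} (hστ : Consistent x σ τ) :
    recoveredTranscript x (directStrategy Γ M i) (σ.map Prod.fst) τ = M.encode σ := by
  induction hστ with
  | nil => rfl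
  | cons I p _ ha ih =>
    simp only [List.map_cons, recoveredTranscript, dif_pos I.2, ih, directStrategy_send,
      relayedReply_encode, ha, M.encode_cons]

lemma relayedStrategy_directStrategy_agreesOnOwnPlay (hM : M.NestedRange)
    (x : PureStrategy Γ M i) :
    AgreesOnOwnPlay (relayedStrategy hM x (directStrategy Γ M i)) x where
  send I τ hτ := by
    simp only [relayedStrategy, hτ.recoveredTranscript_directStrategy, directStrategy_send,
      relayedMessage_encode, ShortList.ofList_val]
  act I τ p τ₀ hτ hτ₀ := by
    have hdepth : Γ.depth ≠ 0 := by
      have := τ.2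
      rw [hτ, List.length_cons] at this
      omega
    have hrecovered := (Consistent.cons I p hτ₀ rfl).recoveredTranscript_directStrategy
    rw [← hτ, ShortList.ofList_val] at hrecovered
    exact directStrategy_act (x.act_legal I τ)
      ((congrArg (fun δ => (ShortList.ofList δ).1.head?) hrecovered).trans
        (ShortList.head?_val_ofList_cons hdepth _ _))

variable (hM : M.NestedRange) (d : PureMediator S Γ.depth) (x : ∀ i, PureStrategy Γ M i)
  {h : List A}

include hM in
lemma playsTo_directMediator_directStrategy_iff (hh : h ∈ Γ.hist) :
    PlaysTo (directMediator d x) (directStrategy Γ M) h ↔ PlaysTo d x h := by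
  rw [playsTo_directMediator_iff hM d x _ hh, playsTo_congr_of_agreesOnOwnPlay
    (fun i => relayedStrategy_directStrategy_agreesOnOwnPlay hM (x i)) hh]

lemma playsTo_directMediator_update_directStrategy_iff (hh : h ∈ Γ.hist) (i : Fin n)
    (y : PureStrategy Γ M i) :
    PlaysTo (directMediator d x) (Function.update (directStrategy Γ M) i y) h ↔
      PlaysTo d (Function.update x i (relayedStrategy hM (x i) y)) h := by
  rw [playsTo_directMediator_iff hM d x _ hh]
  refine playsTo_congr_of_agreesOnOwnPlay (fun j => ?_) hh
  obtain rfl | hj := eq_or_ne j i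
  · simpa only [Function.update_self] using AgreesOnOwnPlay.refl _
  · simpa only [Function.update_of_ne hj] using
      relayedStrategy_directStrategy_agreesOnOwnPlay hM (x j)

end DirectStrategy

namespace Profile

variable [Fintype Info] [Fintype S] (e : Profile Γ M) {i : Fin n}

open Classical in
lemma realization_eq_expect (z : List A) : e.realization z =
    expect e.mediator fun d =>
      expect (piDist e.player) fun x => if PlaysTo d x z then 1 else 0 := by
  simp only [realization, expect, Finset.mul_sum, mul_assoc]
  rfl

lemma expectedUtility_congr {e e' : Profile Γ M} (he : e.RealizationEquivalent e') (i : Fin n) :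
    e.expectedUtility i = e'.expectedUtility i :=
  Finset.sum_congr rfl fun z hz => by rw [he z hz]

open Classical in
/-- The profile in which the mediator draws a pure mediator strategy and a pure strategy of each
player from `e` and runs the relays with them, and the players are direct. -/
def direct : Profile Γ M where
  mediator :=
    stdSimplex.map (fun c => directMediator c.1 c.2) (prodDist e.mediator (piDist e.player))
  player i := stdSimplex.vertex (directStrategy Γ M i)

lemma directMediator_of_direct_mediator_ne_zero {d : PureMediator S Γ.depth}
    (hd : e.direct.mediator.1 d ≠ 0) : DirectMediator M d := by
  obtain ⟨c, rfl⟩ := mem_range_of_map_ne_zero hd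
  exact directMediator_directMediator c.1 c.2

lemma directStrategy_of_direct_player_ne_zero {x : PureStrategy Γ M i}
    (hx : (e.direct.player i).1 x ≠ 0) : DirectStrategy x := by
  classical
  obtain rfl : x = directStrategy Γ M i := by
    by_contra hne
    exact hx (Pi.single_eq_of_ne hne _)
  exact directStrategy_directStrategy i

/-- The mixed strategy with which player `i` imitates in `e` her deviation to `y` in `e.direct`:
she draws a strategy of her own for the relay that she runs. -/
def relayedDeviation (hM : M.NestedRange) (y : stdSimplex ℝ (PureStrategy Γ M i)) :
    stdSimplex ℝ (PureStrategy Γ M i) :=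
  stdSimplex.map (fun c => relayedStrategy hM c.1 c.2) (prodDist (e.player i) y)

variable (hM : M.NestedRange)

include hM in
lemma realizationEquivalent_direct : e.RealizationEquivalent e.direct := by
  classical
  intro z hz
  simp only [realization_eq_expect, direct, expect_map, expect_prodDist, piDist_vertex,
    expect_vertex, Function.comp_def,
    playsTo_directMediator_directStrategy_iff hM _ _ (mem_hist_of_mem_terminals hz)]

lemma realizationEquivalent_deviate_direct (y : stdSimplex ℝ (PureStrategy Γ M i)) :
    (e.deviate i (e.relayedDeviation hM y)).RealizationEquivalent (e.direct.deviate i y) := by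
  classical
  intro z hz
  -- On the left the strategy run by the relay of `i` is a fresh draw of her own; on the right it is
  -- the one drawn together with those of the other players.
  have hredraw (f : (∀ j, PureStrategy Γ M j) → ℝ) : expect (piDist e.player) f =
      expect (piDist e.player) fun x => expect (e.player i) fun a => f (Function.update x i a) := by
    simpa only [Function.update_eq_self] using expect_piDist_update e.player i (e.player i) f
  simp only [realization_eq_expect, deviate, direct, relayedDeviation, expect_map, expect_prodDist,
    expect_piDist_update, piDist_vertex, expect_vertex, Function.comp_def,
    playsTo_directMediator_update_directStrategy_iff hM _ _ (mem_hist_of_mem_terminals hz)]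
  refine congrArg (expect e.mediator) (funext fun d => ?_)
  rw [hredraw fun x => expect y fun b => _]
  simp only [Function.update_self, Function.update_idem]

include hM in
lemma IsCertificationEquilibrium.direct {e : Profile Γ M} (he : e.IsCertificationEquilibrium) :
    e.direct.IsCertificationEquilibrium := by
  intro i y
  rw [← expectedUtility_congr (e.realizationEquivalent_deviate_direct hM y),
    ← expectedUtility_congr (e.realizationEquivalent_direct hM)]
  exact he i _

end Profile

end MediatedGame

end

theorem proposition2 {n : ℕ} {A Info S : Type*} [Fintype A] [Fintype Info] [Fintype S]
    (Γ : MediatedGame.TimedGame n A Info) (M : MediatedGame.MessageSystem A Info S)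
    (hM : M.NestedRange) (e : MediatedGame.Profile Γ M) (he : e.IsCertificationEquilibrium) :
    ∃ e' : MediatedGame.Profile Γ M,
      e'.IsDirectEquilibrium ∧ e.RealizationEquivalent e' :=
  ⟨e.direct, ⟨he.direct hM, fun _ => e.directMediator_of_direct_mediator_ne_zero,
    fun _ _ => e.directStrategy_of_direct_player_ne_zero⟩, e.realizationEquivalent_direct hM⟩
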